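/- Let $F$ be an imaginary quadratic field with a fixed embedding $F\subset\mathbb{C}$, and let $n\ge 1$. For row vectors $x\in\mathbb{C}^n$ and column vectors $y\in\mathbb{C}^n$ write $\langle x,y\rangle=xy=\sum_i x_iy_i$. For an $n\times n$ complex matrix $\sigma$ with columns $\sigma_1,\dots,\sigma_n$ put $$f(\sigma)(x)=\frac{\det\sigma}{\langle x,\sigma_1\rangle\cdots\langle x,\sigma_n\rangle},\qquad f(\sigma)(P,x)=P(-\partial_{x_1},\dots,-\partial_{x_n})f(\sigma)(x)$$ for $P\in\mathbb{C}[X_1,\dots,X_n]$ and $x$ with all $\langle x,\sigma_j\rangle\ne 0$; set $f(\sigma)(P,x)=0$ if some $\langle x,\sigma_j\rangle=0$. For $\mathfrak{A}=(A_1,\dots,A_n)\in GL_n(\mathbb{C})^n$, where $A_{i,j}$ denotes the $j$-th column of $A_i$, and $x\neq0$, let $j_i$ be the smallest index with $\langle x,A_{i,j_i}\rangle\neq 0$, and define $$\psi(\mathfrak{A})(P,x)=f(A_{1,j_1},\dots,A_{n,j_n})(P,x),\qquad \psi(\mathfrak{A})(P,0)=0.$$ Let $R_n$ be the set of matrices $M=(\rho_j(m_i))_{i,j}\in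 GL_n(\mathbb{C})$, where $m_1,\dots,m_n$ are elements of some extension $K/F$ of degree $n$ and $\rho_1,\dots,\rho_n$ are the distinct embeddings of $K$ into $\mathbb{C}$ fixing $F$. For $k\in\mathbb{Z}$, $s\in\mathbb{C}$ and $M\in R_n$ with columns $M_1,\dots,M_n$ put $$\Omega_s^k(x,M)=\prod_{i=1}^n\frac{\overline{xM_i}^{\,k}}{|xM_i|^{2s}}.$$ Let $\mathbf{\Lambda}=\Lambda_1\times\cdots\times\Lambda_n$, where each $\Lambda_i$ is a lattice in $F$ (a finitely generated subgroup spanning $F$ over $\mathbb{Q}$) with ring of multipliers $\{a\in F: a\Lambda_i\subseteq\Lambda_i\}=\mathcal{O}_F$. Theorem. Fix $\mathfrak{A}\in GL_n(F)^n$, a homogeneous polynomial $P\in\mathbb{C}[X_1,\dots,X_n]$ (of any degree $g\ge 0$), $\mathbf{u}\in F^n$, $M\in R_n$ and $k\in\mathbb{Z}$. Then the series $$\Psi_s(\mathfrak{A})(P,\mathbf{u},M)=\sum_{x\in\mathbf{\Lambda}+\mathbf{u}}\psi(\mathfrak{A})(P,x)\,\Omega_s^k(x,M)$$ converges absolutely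 for every $s\in\mathbb{C}$ with $\mathrm{Re}(s)>1+\frac{k}{2}$. (If $0\in\mathbf{\Lambda}+\mathbf{u}$, the term at $x=0$ is $0$.) -/

import Mathlib

open scoped MatrixGroups Matrix

noncomputable section

namespace EisensteinCocycle

universe u

/-- The rational function `f(σ)(x) = det σ / (⟨x, σ₁⟩ ⋯ ⟨x, σₙ⟩)` of a row vector `x`, where `σⱼ` is
the `j`-th column of `σ` and `⟨x, σⱼ⟩ = x σⱼ` is bilinear. It is `0` where a denominator vanishes. -/
def ratFun {n : ℕ} (σ : Matrix (Fin n) (Fin n) ℂ) (x : Fin n → ℂ) : ℂ :=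
  σ.det / ∏ j, x ⬝ᵥ σ.col j

/-- The complex partial derivative `∂g/∂xⱼ` of a function on `ℂⁿ`. -/
def partialDeriv {n : ℕ} (j : Fin n) (g : (Fin n → ℂ) → ℂ) : (Fin n → ℂ) → ℂ :=
  fun x => lineDeriv ℂ g x (Pi.single j 1)

/-- The iterated partial derivative `∂₁^{α₁} ⋯ ∂ₙ^{αₙ} g`. -/
def multiDeriv {n : ℕ} (α : Fin n →₀ ℕ) (g : (Fin n → ℂ) → ℂ) : (Fin n → ℂ) → ℂ :=
  (List.finRange n).foldr (fun j h => (partialDeriv j)^[α j] h) g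

/-- The differential operator `P(-∂₁, …, -∂ₙ)` applied to `g`. -/
def negDiffOp {n : ℕ} (P : MvPolynomial (Fin n) ℂ) (g : (Fin n → ℂ) → ℂ) (x : Fin n → ℂ) : ℂ :=
  ∑ α ∈ P.support, P.coeff α * (-1) ^ α.degree * multiDeriv α g x

/-- `f(σ)(P, x) = P(-∂₁, …, -∂ₙ) f(σ)(x)` off the hyperplanes `⟨x, σⱼ⟩ = 0`, and `0` on them. -/
def ratFunDeriv {n : ℕ} (σ : Matrix (Fin n) (Fin n) ℂ) (P : MvPolynomial (Fin n) ℂ)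
    (x : Fin n → ℂ) : ℂ :=
  open Classical in
  if ∀ j, x ⬝ᵥ σ.col j ≠ 0 then negDiffOp P (ratFun σ) x else 0

/-- A nonzero row vector has a nonzero product with some column of an invertible matrix. -/
theorem exists_col_ne_zero {n : ℕ} (A : GL (Fin n) ℂ) {x : Fin n → ℂ} (hx : x ≠ 0) :
    ∃ j, x ⬝ᵥ (A : Matrix (Fin n) (Fin n) ℂ).col j ≠ 0 := by
  by_contra! h
  apply hx
  have h0 : x ᵥ* (A : Matrix (Fin n) (Fin n) ℂ) = 0 := by
    funext j
    exact h j
  have h1 : x ᵥ* ((A : Matrix (Fin n) (Fin n) ℂ) * ((A⁻¹ : GL (Fin n) ℂ) : Matrix _ _ ℂ)) = 0 := by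
    rw [← Matrix.vecMul_vecMul, h0, Matrix.zero_vecMul]
  rw [← Units.val_mul, mul_inv_cancel, Units.val_one, Matrix.vecMul_one] at h1
  exact h1

/-- The smallest index `j` such that `⟨x, A_j⟩ ≠ 0`, for a nonzero row vector `x`. -/
def firstIndex {n : ℕ} (A : GL (Fin n) ℂ) {x : Fin n → ℂ} (hx : x ≠ 0) : Fin n :=
  open Classical in
  Fin.find (fun j => x ⬝ᵥ (A : Matrix (Fin n) (Fin n) ℂ).col j ≠ 0) (exists_col_ne_zero A hx)

/-- The rational cocycle `ψ(A₁, …, Aₙ)(P, x) = f(A_{1 j₁}, …, A_{n jₙ})(P, x)`, where `A_{k jₖ}` is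
the first column of `Aₖ` not orthogonal to `x`; it is `0` at `x = 0`. -/
def psi {n : ℕ} (A : Fin n → GL (Fin n) ℂ) (P : MvPolynomial (Fin n) ℂ) (x : Fin n → ℂ) : ℂ :=
  open Classical in
  if hx : x = 0 then 0
  else ratFunDeriv
    (Matrix.of fun i k => (A k : Matrix (Fin n) (Fin n) ℂ) i (firstIndex (A k) hx)) P x

/-- The convergence factor `Ω_s^k(x, M) = ∏ᵢ conj(x Mᵢ)^k / |x Mᵢ|^{2s}`. -/
def Omega {n : ℕ} (k : ℤ) (s : ℂ) (x : Fin n → ℂ) (M : GL (Fin n) ℂ) : ℂ :=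
  ∏ i, (starRingEnd ℂ (x ⬝ᵥ (M : Matrix (Fin n) (Fin n) ℂ).col i)) ^ k /
    ((‖x ⬝ᵥ (M : Matrix (Fin n) (Fin n) ℂ).col i‖ : ℂ) ^ (2 * s))

/-- The set `R_n` of invertible complex matrices `(ρⱼ(mᵢ))ᵢⱼ`, where `m₁, …, mₙ` are elements of some
extension `K / F` of degree `n` and `ρ₁, …, ρₙ` are the distinct embeddings of `K` into `ℂ`
fixing `F` (that is, restricting to the given embedding of `F` into `ℂ`). -/
def conjugateMatrices (F : Type u) [Field F] [Algebra F ℂ] (n : ℕ) : Set (GL (Fin n) ℂ) :=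
  {M | ∃ (K : Type u) (_ : Field K) (_ : Algebra F K) (m : Fin n → K) (ρ : Fin n → (K →ₐ[F] ℂ)),
    FiniteDimensional F K ∧ Module.finrank F K = n ∧ Function.Injective ρ ∧
      ∀ i j, (M : Matrix (Fin n) (Fin n) ℂ) i j = ρ j (m i)}

/-- The ring of multipliers `{a ∈ F : a L ⊆ L}` of an additive subgroup `L` of `F`. -/
def multiplierRing {F : Type u} [Field F] (L : Submodule ℤ F) : Subring F where
  carrier := {a | ∀ x ∈ L, a * x ∈ L}
  mul_mem' {a b} ha hb x hx := by
    rw [mul_assoc]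
    exact ha _ (hb x hx)
  one_mem' x hx := by rwa [one_mul]
  add_mem' {a b} ha hb x hx := by
    rw [add_mul]
    exact L.add_mem (ha x hx) (hb x hx)
  zero_mem' x _ := by
    rw [zero_mul]
    exact L.zero_mem
  neg_mem' {a} ha x hx := by
    rw [neg_mul]
    exact L.neg_mem (ha x hx)

/-- The coset `𝚲 + 𝐮` in `Fⁿ`, where `𝚲 = Λ₁ × ⋯ × Λₙ`. -/
def latticeCoset {F : Type u} [Field F] {n : ℕ} (Λ : Fin n → Submodule ℤ F) (v : Fin n → F) :
    Set (Fin n → F) :=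
  {x | ∀ i, x i - v i ∈ Λ i}

/-- The term `ψ(𝔄)(P, x) Ω_s^k(x, M)` of the Eisenstein series, for `𝔄 ∈ GLₙ(F)ⁿ` and `x ∈ Fⁿ`. -/
def eisensteinTerm {F : Type u} [Field F] [Algebra F ℂ] {n : ℕ} (k : ℤ) (s : ℂ)
    (A : Fin n → GL (Fin n) F) (P : MvPolynomial (Fin n) ℂ) (M : GL (Fin n) ℂ)
    (x : Fin n → F) : ℂ :=
  psi (fun i => Matrix.GeneralLinearGroup.map (algebraMap F ℂ) (A i)) P
      (fun i => algebraMap F ℂ (x i)) *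
    Omega k s (fun i => algebraMap F ℂ (x i)) M

/-- The Eisenstein cocycle `Ψ_s(𝔄)(P, 𝐮, M) = ∑_{x ∈ 𝚲 + 𝐮} ψ(𝔄)(P, x) Ω_s^k(x, M)`. -/
def Psi {F : Type u} [Field F] [Algebra F ℂ] {n : ℕ} (Λ : Fin n → Submodule ℤ F) (k : ℤ) (s : ℂ)
    (A : Fin n → GL (Fin n) F) (P : MvPolynomial (Fin n) ℂ) (v : Fin n → F)
    (M : GL (Fin n) ℂ) : ℂ :=
  ∑' x : latticeCoset Λ v, eisensteinTerm k s A P M x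

end EisensteinCocycle

end

/-! The coordinates of `xM` are the conjugates over `F` of `y = ∑ xᵢ mᵢ ∈ K`, so `∏ⱼ |xMⱼ|` is the
absolute value of the norm of `y` to `F`. On a finitely generated group these norms have bounded
denominators, and a nonzero integer of `F` has absolute value at least 1. So the product is bounded
below, both at nonzero points of the coset and at differences of distinct points
(`exists_le_prod_norm_of_mem_conjugateMatrices`).

A nonzero term has size `|ψ| ∏ⱼ |xMⱼ|^(-w)` with `w = 2 Re s - k > 2`. For `n ≥ 2` the product alone
is not summable, being invariant under infinitely many units of `K`. The missing decay comes from `ψ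
= O(1/‖x‖)` (`exists_norm_psi_mul_norm_le`): derivatives of `f(σ)` are polynomials in the `1/⟨x,
σⱼ⟩` divisible by each of them, and nonzero values of these forms are bounded below.

For `summable_of_prod_norm_sub`, sort points by dyadic sizes `|zⱼ| ≈ 2^(bⱼ)`. Separation allows
`O(4^(∑ b))` points per class, which contribute `O(2^(-(w-2)∑ b - max b))`. As `∑ b` is bounded
below, `max b` controls `∑ |bⱼ|`, and a product of geometric series remains. -/

noncomputable section

namespace EisensteinCocycle

universe u

/-! ### Counting separated points and the convergence criterion -/

/-- Points of `ℂⁿ` whose differences have coordinates with product at least `c` in absolute value: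
the number of them in a polydisc is at most a constant times its squared volume. -/
theorem card_le_of_prod_norm_sub {ι : Type*} {n : ℕ} (hn : n ≠ 0) (z : ι → Fin n → ℂ) {c : ℝ}
    (hc : 0 < c) (hsep : ∀ x y, x ≠ y → c ≤ ∏ i, ‖z x i - z y i‖) (r : Fin n → ℝ)
    (hr : ∀ i, 0 < r i) (hrc : c ≤ ∏ i, r i) (T : Finset ι) (hT : ∀ x ∈ T, ∀ i, ‖z x i‖ < r i) :
    (T.card : ℝ) ≤ 81 ^ n * ((∏ i, r i) / c) ^ 2 := by
  set q : ℝ := (∏ i, r i) / c with hq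
  have hq1 : 1 ≤ q := (one_le_div hc).2 hrc
  -- Pigeonhole: with cells of side `r i / m`, two points in one cell differ by a product at most
  -- `(2t/m)^n c`, which is less than `c` once `m > 2t`. So each cell holds at most one point.
  obtain ⟨t, ht1, htq⟩ : ∃ t : ℝ, 1 ≤ t ∧ t ^ n = q :=
    ⟨q ^ (n : ℝ)⁻¹, Real.one_le_rpow hq1 (by positivity),
      Real.rpow_inv_natCast_pow (by positivity) hn⟩
  obtain ⟨m, hm2, hm3⟩ : ∃ m : ℕ, 2 * t < m ∧ (m : ℝ) ≤ 3 * t :=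
    ⟨⌊2 * t⌋₊ + 1, by exact_mod_cast Nat.lt_floor_add_one (2 * t), by
      have := Nat.floor_le (by positivity : 0 ≤ 2 * t)
      push_cast
      linarith⟩
  have hm0 : (0 : ℝ) < m := by linarith
  let box : Finset (ℤ × ℤ) := Finset.Icc (-(m : ℤ)) m ×ˢ Finset.Icc (-(m : ℤ)) m
  let cell : ι → Fin n → ℤ × ℤ := fun x i => (⌊(z x i).re * m / r i⌋, ⌊(z x i).im * m / r i⌋)
  have hfloor : ∀ (i : Fin n) (a : ℝ), |a| < r i → ⌊a * m / r i⌋ ∈ Finset.Icc (-(m : ℤ)) m := by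
    intro i a ha
    obtain ⟨h1, h2⟩ := abs_lt.1 ha
    have h3 : -(m : ℝ) ≤ a * m / r i := by rw [le_div_iff₀ (hr i)]; nlinarith
    have h4 : a * m / r i ≤ m := by rw [div_le_iff₀ (hr i)]; nlinarith
    rw [Finset.mem_Icc, Int.le_floor]
    refine ⟨by exact_mod_cast h3, ?_⟩
    exact_mod_cast (Int.floor_le _).trans h4
  have hmaps : ∀ x ∈ T, cell x ∈ Fintype.piFinset fun _ : Fin n => box := fun x hx => by
    rw [Fintype.mem_piFinset]
    exact fun i => Finset.mem_product.2
      ⟨hfloor i _ ((Complex.abs_re_le_norm _).trans_lt (hT x hx i)),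
        hfloor i _ ((Complex.abs_im_le_norm _).trans_lt (hT x hx i))⟩
  have hdiff : ∀ (i : Fin n) (a b : ℝ), ⌊a * m / r i⌋ = ⌊b * m / r i⌋ → |a - b| ≤ r i / m := by
    intro i a b h
    have h1 := Int.abs_sub_lt_one_of_floor_eq_floor h
    rw [← sub_div, ← sub_mul, abs_div, abs_mul, abs_of_pos hm0, abs_of_pos (hr i),
      div_lt_one (hr i)] at h1
    exact (le_div_iff₀ hm0).2 h1.le
  have hinj : Set.InjOn cell T := by
    intro x _ y _ hxy
    by_contra hne
    have hle : ∏ i, ‖z x i - z y i‖ ≤ ∏ i, 2 / m * r i := by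
      refine Finset.prod_le_prod (fun i _ => norm_nonneg _) fun i _ => ?_
      have h := congrFun hxy i
      have h1 := hdiff i _ _ (congrArg Prod.fst h)
      have h2 := hdiff i _ _ (congrArg Prod.snd h)
      calc ‖z x i - z y i‖ ≤ |(z x i - z y i).re| + |(z x i - z y i).im| :=
            Complex.norm_le_abs_re_add_abs_im _
        _ ≤ r i / m + r i / m := add_le_add h1 h2
        _ = 2 / m * r i := by ring
    have hlt : ∏ i, 2 / m * r i < c := by
      have hprod : ∏ i, r i = t ^ n * c := by rw [htq, hq, div_mul_cancel₀ _ hc.ne']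
      rw [Finset.prod_mul_distrib, hprod, Finset.prod_const, Finset.card_univ, Fintype.card_fin,
        ← mul_assoc, ← mul_pow]
      refine mul_lt_of_lt_one_left hc (pow_lt_one₀ (by positivity) ?_ hn)
      rw [div_mul_eq_mul_div, div_lt_one hm0]
      exact hm2
    exact absurd (hsep x y hne) (not_le.2 (hle.trans_lt hlt))
  have hcard := Finset.card_le_card_of_injOn cell hmaps hinj
  -- `2m + 1 ≤ 6t + 1 ≤ 9t`, which is the source of `81 = 9²`.
  have hbox : (box.card : ℝ) ≤ (9 * t) ^ 2 := by
    have h : (box.card : ℝ) = (2 * m + 1) ^ 2 := by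
      rw [Finset.card_product, Int.card_Icc,
        show ((m : ℤ) + 1 - -(m : ℤ)).toNat = 2 * m + 1 by omega]
      push_cast
      ring
    rw [h]
    exact pow_le_pow_left₀ (by positivity) (by linarith) 2
  calc (T.card : ℝ) ≤ (box.card : ℝ) ^ n := by
        rw [Fintype.card_piFinset_const] at hcard
        exact_mod_cast hcard
    _ ≤ ((9 * t) ^ 2) ^ n := pow_le_pow_left₀ (by positivity) hbox n
    _ = 81 ^ n * q ^ 2 := by
        rw [← htq, mul_pow, mul_pow, ← pow_mul, ← pow_mul, ← pow_mul, mul_comm 2 n, pow_mul (9 : ℝ),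
          pow_right_comm]
        norm_num

theorem sum_prod_le_tsum_pow {n : ℕ} {g : ℤ → ℝ} (hg0 : ∀ m, 0 ≤ g m) (hg : Summable g)
    (B : Finset (Fin n → ℤ)) : ∑ b ∈ B, ∏ i, g (b i) ≤ (∑' m, g m) ^ n := by
  let t : Fin n → Finset ℤ := fun i => B.image fun b => b i
  calc ∑ b ∈ B, ∏ i, g (b i)
      ≤ ∑ b ∈ Fintype.piFinset t, ∏ i, g (b i) :=
        Finset.sum_le_sum_of_subset_of_nonneg
          (fun b hb => Fintype.mem_piFinset.2 fun i => Finset.mem_image_of_mem (fun b => b i) hb)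
          fun b _ _ => Finset.prod_nonneg fun i _ => hg0 _
    _ = ∏ i, ∑ m ∈ t i, g m := (Finset.prod_univ_sum t fun _ m => g m).symm
    _ ≤ ∏ _i : Fin n, ∑' m, g m :=
        Finset.prod_le_prod (fun i _ => Finset.sum_nonneg fun m _ => hg0 m)
          fun i _ => hg.sum_le_tsum _ fun m _ => hg0 m
    _ = (∑' m, g m) ^ n := by simp

theorem summable_two_rpow_neg_abs {δ : ℝ} (hδ : 0 < δ) :
    Summable fun m : ℤ => (2 : ℝ) ^ (-(δ * |(m : ℝ)|)) := by
  have h : Summable fun m : ℕ => (2 : ℝ) ^ (-(δ * (m : ℝ))) := by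
    have h1 : Summable fun m : ℕ => ((2 : ℝ) ^ (-δ)) ^ m :=
      summable_geometric_of_lt_one (by positivity)
        (Real.rpow_lt_one_of_one_lt_of_neg one_lt_two (neg_lt_zero.2 hδ))
    refine h1.congr fun m => ?_
    rw [← Real.rpow_natCast, ← Real.rpow_mul zero_le_two, neg_mul]
  refine summable_int_iff_summable_nat_and_neg.2 ⟨?_, ?_⟩ <;> simpa using h

/-- A lower bound on the sum stops negative entries from being large unless the maximum is large
too; termwise, `|bⱼ| ≤ 2(bᵢ + κ) - bⱼ`. -/
theorem sum_abs_le_of_le_sum {n : ℕ} (b : Fin n → ℝ) (i : Fin n) (hi : ∀ j, b j ≤ b i)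
    {κ : ℝ} (hκ : 0 ≤ κ) (hb : -κ ≤ ∑ j, b j) : ∑ j, |b j| ≤ 2 * n * (b i + κ) + κ := by
  have hn : (1 : ℝ) ≤ n := by exact_mod_cast Fin.pos i
  have hsum : ∑ j, b j ≤ n * b i := by
    simpa using Finset.sum_le_sum fun j (_ : j ∈ Finset.univ) => hi j
  have hpos : 0 ≤ b i + κ := by
    by_contra! h
    nlinarith
  calc ∑ j, |b j| ≤ ∑ j, (2 * (b i + κ) - b j) := by
        refine Finset.sum_le_sum fun j _ => ?_
        have := hi j
        rcases abs_cases (b j) with ⟨h, _⟩ | ⟨h, _⟩ <;> rw [h] <;> linarith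
    _ = 2 * n * (b i + κ) - ∑ j, b j := by
        rw [Finset.sum_sub_distrib, Finset.sum_const, Finset.card_univ, Fintype.card_fin,
          nsmul_eq_mul]
        ring
    _ ≤ _ := by linarith

/-- The convergence criterion: `z` is a family of points of `ℂⁿ` such that the products of the
coordinates of the points and of their differences are bounded below, and `f = O(‖z‖⁻¹ ∏ |zⱼ|^{-w})`
with `w > 2`. -/
theorem summable_of_prod_norm_sub {ι : Type*} {n : ℕ} (hn : n ≠ 0) (z : ι → Fin n → ℂ) {c : ℝ}
    (hc : 0 < c) (hsep : ∀ x y, x ≠ y → c ≤ ∏ i, ‖z x i - z y i‖) (hz : ∀ x i, z x i ≠ 0)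
    (hzc : ∀ x, c ≤ ∏ i, ‖z x i‖) {w : ℝ} (hw : 2 < w) {f : ι → ℝ} (hf0 : ∀ x, 0 ≤ f x) {C : ℝ}
    (hC : 0 ≤ C) (hf : ∀ x i, f x * ‖z x i‖ ≤ C * ∏ j, ‖z x j‖ ^ (-w)) : Summable f := by
  classical
  have : Nonempty (Fin n) := ⟨⟨0, Nat.pos_of_ne_zero hn⟩⟩
  have hn0 : (0 : ℝ) < n := by exact_mod_cast Nat.pos_of_ne_zero hn
  have hn1 : (1 : ℝ) ≤ n := by exact_mod_cast Nat.pos_of_ne_zero hn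
  set δ : ℝ := (2 * n)⁻¹ with hδ
  have hδ0 : 0 < δ := by positivity
  -- Every dyadic class `b` that occurs satisfies `∑ b ≥ -κ`, because `c ≤ ∏ 2^(bᵢ + 1)`.
  set κ : ℝ := max 0 (n - Real.logb 2 c) with hκ
  have hκ0 : 0 ≤ κ := le_max_left _ _
  let a : ι → Fin n → ℤ := fun x i => Int.log 2 ‖z x i‖
  have ha1 : ∀ x i, (2 : ℝ) ^ (a x i : ℝ) ≤ ‖z x i‖ := fun x i => by
    rw [Real.rpow_intCast]
    exact_mod_cast Int.zpow_log_le_self (b := 2) one_lt_two (norm_pos_iff.2 (hz x i))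
  have ha2 : ∀ x i, ‖z x i‖ < (2 : ℝ) ^ (a x i + 1 : ℝ) := fun x i => by
    have h := Int.lt_zpow_succ_log_self (b := 2) one_lt_two ‖z x i‖
    rw [← Int.cast_one, ← Int.cast_add, Real.rpow_intCast]
    exact_mod_cast h
  set D : ℝ := 81 ^ n * (2 ^ (n : ℝ) / c) ^ 2 * C * 2 ^ ((w - 2) * κ + 2 * κ) with hD
  have hfiber : ∀ (T : Finset ι) (b : Fin n → ℤ), b ∈ T.image a →
      ∑ x ∈ T with a x = b, f x ≤ D * ∏ i, (2 : ℝ) ^ (-(δ * |(b i : ℝ)|)) := by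
    intro T b hb
    obtain ⟨x₀, -, hx₀⟩ := Finset.mem_image.1 hb
    set s : ℝ := ∑ i, (b i : ℝ) with hs
    have hprod : ∏ i, (2 : ℝ) ^ (b i + 1 : ℝ) = 2 ^ s * 2 ^ (n : ℝ) := by
      rw [← Real.rpow_sum_of_pos two_pos, Finset.sum_add_distrib, Real.rpow_add two_pos]
      simp [hs]
    have hcb : c ≤ ∏ i, (2 : ℝ) ^ (b i + 1 : ℝ) := by
      refine (hzc x₀).trans (Finset.prod_le_prod (fun i _ => norm_nonneg _) fun i _ => ?_)
      rw [← hx₀]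
      exact (ha2 x₀ i).le
    have hsκ : -κ ≤ s := by
      have h1 : Real.logb 2 c ≤ s + n := by
        rw [Real.logb_le_iff_le_rpow one_lt_two hc, Real.rpow_add two_pos, ← hprod]
        exact hcb
      have h2 : (n : ℝ) - Real.logb 2 c ≤ κ := le_max_right _ _
      linarith
    have hcard := card_le_of_prod_norm_sub hn z hc hsep (fun i => (2 : ℝ) ^ (b i + 1 : ℝ))
      (fun i => by positivity) hcb (T.filter fun x => a x = b) fun x hx i => by
        rw [← (Finset.mem_filter.1 hx).2]
        exact ha2 x i
    -- The bound `hf` is strongest at the largest coordinate.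
    obtain ⟨i, hi⟩ := Finite.exists_max b
    have hterm : ∀ x ∈ T.filter fun x => a x = b, f x ≤ C * 2 ^ (-(b i : ℝ) - w * s) := by
      intro x hx
      obtain rfl := (Finset.mem_filter.1 hx).2
      have h1 : ∏ j, ‖z x j‖ ^ (-w) ≤ 2 ^ (-(w * s)) := by
        have h2 : ∏ j, ((2 : ℝ) ^ (a x j : ℝ)) ^ (-w) = 2 ^ (-(w * s)) := by
          rw [Real.finsetProd_rpow _ _ fun j _ => by positivity, ← Real.rpow_sum_of_pos two_pos,
            ← Real.rpow_mul zero_le_two, mul_neg, mul_comm]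
        rw [← h2]
        exact Finset.prod_le_prod (fun j _ => by positivity) fun j _ =>
          Real.rpow_le_rpow_of_nonpos (by positivity) (ha1 x j) (by linarith)
      have h3 : f x * 2 ^ (a x i : ℝ) ≤ C * 2 ^ (-(w * s)) :=
        (mul_le_mul_of_nonneg_left (ha1 x i) (hf0 x)).trans
          ((hf x i).trans (mul_le_mul_of_nonneg_left h1 hC))
      rw [sub_eq_neg_add, Real.rpow_add two_pos, Real.rpow_neg zero_le_two (a x i : ℝ), ← mul_assoc,
        ← div_eq_mul_inv, le_div_iff₀ (by positivity)]
      exact h3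
    -- `2s` comes from the point count. Since `w > 2`, the part `-(w-2)s` is at most `(w-2)κ`, while
    -- `-bᵢ` supplies decay in every `|bⱼ|`.
    have hexp : 2 * s + (-(b i : ℝ) - w * s) ≤
        ((w - 2) * κ + 2 * κ) + ∑ j, -(δ * |(b j : ℝ)|) := by
      have h1 := sum_abs_le_of_le_sum (fun j => (b j : ℝ)) i
        (fun j => by exact_mod_cast hi j) hκ0 hsκ
      have h2 : δ * ∑ j, |(b j : ℝ)| ≤ b i + 2 * κ := by
        rw [hδ, inv_mul_le_iff₀ (by positivity)]
        nlinarith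
      rw [Finset.sum_neg_distrib, ← Finset.mul_sum]
      nlinarith
    calc ∑ x ∈ T with a x = b, f x
        ≤ (T.filter fun x => a x = b).card * (C * 2 ^ (-(b i : ℝ) - w * s)) := by
          rw [← nsmul_eq_mul]
          exact Finset.sum_le_card_nsmul _ _ _ hterm
      _ ≤ 81 ^ n * ((2 ^ s * 2 ^ (n : ℝ)) / c) ^ 2 * (C * 2 ^ (-(b i : ℝ) - w * s)) := by
          rw [hprod] at hcard
          exact mul_le_mul_of_nonneg_right hcard (by positivity)
      _ = 81 ^ n * (2 ^ (n : ℝ) / c) ^ 2 * C * 2 ^ (2 * s + (-(b i : ℝ) - w * s)) := by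
          rw [Real.rpow_add two_pos (2 * s), mul_comm 2 s, Real.rpow_mul zero_le_two,
            Real.rpow_two]
          ring
      _ ≤ 81 ^ n * (2 ^ (n : ℝ) / c) ^ 2 * C *
            2 ^ (((w - 2) * κ + 2 * κ) + ∑ j, -(δ * |(b j : ℝ)|)) :=
          mul_le_mul_of_nonneg_left (Real.rpow_le_rpow_of_exponent_le one_le_two hexp)
            (by positivity)
      _ = D * ∏ i, (2 : ℝ) ^ (-(δ * |(b i : ℝ)|)) := by
          rw [Real.rpow_add two_pos, Real.rpow_sum_of_pos two_pos, ← mul_assoc]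
  refine summable_of_sum_le (c := D * (∑' m : ℤ, (2 : ℝ) ^ (-(δ * |(m : ℝ)|))) ^ n) hf0 fun T => ?_
  rw [← Finset.sum_fiberwise_of_maps_to (fun x hx => Finset.mem_image_of_mem a hx) f]
  refine (Finset.sum_le_sum (hfiber T)).trans ?_
  rw [← Finset.mul_sum]
  exact mul_le_mul_of_nonneg_left
    (sum_prod_le_tsum_pow (fun m => by positivity) (summable_two_rpow_neg_abs hδ0) _)
    (by positivity)

/-! ### Derivatives of `f(σ)` as polynomials in the reciprocal forms -/

/-- The reciprocals `1 / ⟨x, σⱼ⟩`. -/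
def invForms {n : ℕ} (σ : Matrix (Fin n) (Fin n) ℂ) (x : Fin n → ℂ) : Fin n → ℂ :=
  fun j => (x ⬝ᵥ σ.col j)⁻¹

/-- The derivation on polynomials in the reciprocals `1 / ⟨x, σⱼ⟩` induced by `∂/∂xᵢ`. -/
def invDerivation {n : ℕ} (σ : Matrix (Fin n) (Fin n) ℂ) (i : Fin n) :
    Derivation ℂ (MvPolynomial (Fin n) ℂ) (MvPolynomial (Fin n) ℂ) :=
  MvPolynomial.mkDerivation ℂ fun j => -(MvPolynomial.C (σ i j) * MvPolynomial.X j ^ 2)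

/-- `Xⱼ` divides its own derivative, a multiple of `Xⱼ²`. So differentiation preserves the factor
`1/⟨x, σⱼ⟩` that gives the decay. -/
theorem X_dvd_invDerivation {n : ℕ} (σ : Matrix (Fin n) (Fin n) ℂ) (i j : Fin n)
    {Q : MvPolynomial (Fin n) ℂ} (h : MvPolynomial.X j ∣ Q) :
    MvPolynomial.X j ∣ invDerivation σ i Q := by
  obtain ⟨R, rfl⟩ := h
  rw [Derivation.leibniz, invDerivation, MvPolynomial.mkDerivation_X, smul_eq_mul, smul_eq_mul]
  exact dvd_add (Dvd.intro _ rfl)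
    (Dvd.intro (R * -(MvPolynomial.C (σ i j) * MvPolynomial.X j)) (by ring))

theorem hasLineDerivAt_eval_invForms {n : ℕ} (σ : Matrix (Fin n) (Fin n) ℂ) (i : Fin n)
    {x : Fin n → ℂ} (hx : ∀ j, x ⬝ᵥ σ.col j ≠ 0) (Q : MvPolynomial (Fin n) ℂ) :
    HasLineDerivAt ℂ (fun y => MvPolynomial.eval (invForms σ y) Q)
      (MvPolynomial.eval (invForms σ x) (invDerivation σ i Q)) x (Pi.single i 1) := by
  induction Q using MvPolynomial.induction_on with
  | C a =>
    simpa [HasLineDerivAt, MvPolynomial.derivation_C] using hasDerivAt_const (0 : ℂ) a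
  | add p q hp hq =>
    simp only [map_add]
    exact HasDerivAt.add hp hq
  | mul_X p j hp =>
    have hX : HasLineDerivAt ℂ (fun y => invForms σ y j)
        (-(σ i j * (invForms σ x j) ^ 2)) x (Pi.single i 1) := by
      have h1 : HasDerivAt (fun t : ℂ => (x + t • Pi.single i (1 : ℂ)) ⬝ᵥ σ.col j)
          (σ i j) 0 := by
        simp only [add_dotProduct, smul_dotProduct, single_dotProduct, one_mul, smul_eq_mul,
          Matrix.col_apply]
        simpa using ((hasDerivAt_id (0 : ℂ)).mul_const (σ i j)).const_add (x ⬝ᵥ σ.col j)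
      have h2 := h1.fun_inv (by simpa using hx j)
      refine h2.congr_deriv ?_
      simp only [invForms, zero_smul, add_zero]
      field_simp
    have h := HasDerivAt.fun_mul hp hX
    simp only [map_mul, MvPolynomial.eval_X]
    refine h.congr_deriv ?_
    simp only [zero_smul, add_zero, Derivation.leibniz, invDerivation,
      MvPolynomial.mkDerivation_X, smul_eq_mul, map_add, map_mul, map_neg, map_pow,
      MvPolynomial.eval_X, MvPolynomial.eval_C]
    ring

theorem isOpen_forms_ne_zero {n : ℕ} (σ : Matrix (Fin n) (Fin n) ℂ) :
    IsOpen {x : Fin n → ℂ | ∀ j, x ⬝ᵥ σ.col j ≠ 0} := by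
  simp only [Set.ofPred_forall]
  refine isOpen_iInter_of_finite fun j => isOpen_ne_fun ?_ continuous_const
  exact Continuous.dotProduct continuous_id continuous_const

/-- Off the hyperplanes `⟨x, σⱼ⟩ = 0`, the function `g` is a polynomial in the reciprocals
`1 / ⟨x, σⱼ⟩` which is divisible by each of them. -/
def IsInvPolynomial {n : ℕ} (σ : Matrix (Fin n) (Fin n) ℂ) (g : (Fin n → ℂ) → ℂ) : Prop :=
  ∃ Q : MvPolynomial (Fin n) ℂ, (∀ j, MvPolynomial.X j ∣ Q) ∧
    ∀ x, (∀ j, x ⬝ᵥ σ.col j ≠ 0) → g x = MvPolynomial.eval (invForms σ x) Q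

theorem isInvPolynomial_ratFun {n : ℕ} (σ : Matrix (Fin n) (Fin n) ℂ) :
    IsInvPolynomial σ (ratFun σ) := by
  refine ⟨MvPolynomial.C σ.det * ∏ j, MvPolynomial.X j, fun j => ?_, fun x _ => ?_⟩
  · exact Dvd.dvd.mul_left (Finset.dvd_prod_of_mem _ (Finset.mem_univ j)) _
  · simp [ratFun, invForms, div_eq_mul_inv]

theorem IsInvPolynomial.partialDeriv {n : ℕ} {σ : Matrix (Fin n) (Fin n) ℂ}
    {g : (Fin n → ℂ) → ℂ} (hg : IsInvPolynomial σ g) (i : Fin n) :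
    IsInvPolynomial σ (partialDeriv i g) := by
  obtain ⟨Q, hQ, hgQ⟩ := hg
  refine ⟨invDerivation σ i Q, fun j => X_dvd_invDerivation σ i j (hQ j), fun x hx => ?_⟩
  have h : g =ᶠ[nhds x] fun y => MvPolynomial.eval (invForms σ y) Q :=
    Filter.eventually_of_mem ((isOpen_forms_ne_zero σ).mem_nhds hx) hgQ
  rw [EisensteinCocycle.partialDeriv, h.lineDeriv_eq]
  exact (hasLineDerivAt_eval_invForms σ i hx Q).lineDeriv

theorem IsInvPolynomial.multiDeriv {n : ℕ} {σ : Matrix (Fin n) (Fin n) ℂ}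
    {g : (Fin n → ℂ) → ℂ} (hg : IsInvPolynomial σ g) (α : Fin n →₀ ℕ) :
    IsInvPolynomial σ (multiDeriv α g) := by
  unfold EisensteinCocycle.multiDeriv
  induction List.finRange n with
  | nil => exact hg
  | cons i l ih =>
    rw [List.foldr_cons]
    generalize α i = r
    induction r with
    | zero => exact ih
    | succ r hr =>
      rw [Function.iterate_succ_apply']
      exact hr.partialDeriv i

theorem IsInvPolynomial.negDiffOp {n : ℕ} {σ : Matrix (Fin n) (Fin n) ℂ}
    {g : (Fin n → ℂ) → ℂ} (hg : IsInvPolynomial σ g) (P : MvPolynomial (Fin n) ℂ) :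
    IsInvPolynomial σ (negDiffOp P g) := by
  choose Q hQ hgQ using fun α => hg.multiDeriv α
  refine ⟨∑ α ∈ P.support, MvPolynomial.C (P.coeff α * (-1) ^ α.degree) * Q α,
    fun j => Finset.dvd_sum fun α _ => (hQ α j).mul_left _, fun x hx => ?_⟩
  simp only [EisensteinCocycle.negDiffOp, map_sum, map_mul, MvPolynomial.eval_C]
  exact Finset.sum_congr rfl fun α _ => by rw [hgQ α x hx]

/-- Where the forms `⟨x, σⱼ⟩` are bounded below, `P(-∂) f(σ)` is `O(1 / |⟨x, σⱼ⟩|)` for each `j`. -/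
theorem exists_norm_ratFunDeriv_mul_le {n : ℕ} (σ : Matrix (Fin n) (Fin n) ℂ)
    (P : MvPolynomial (Fin n) ℂ) {c : ℝ} (hc : 0 < c) :
    ∃ C, 0 ≤ C ∧ ∀ x, (∀ j, x ⬝ᵥ σ.col j ≠ 0 → c ≤ ‖x ⬝ᵥ σ.col j‖) →
      ∀ j, ‖ratFunDeriv σ P x‖ * ‖x ⬝ᵥ σ.col j‖ ≤ C := by
  obtain ⟨Q, hQ, hPQ⟩ := (isInvPolynomial_ratFun σ).negDiffOp P
  choose R hR using hQ
  -- Once one factor `1/⟨x, σⱼ⟩` is cancelled, the cofactor is evaluated at reciprocals of size at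
  -- most `c⁻¹`, that is, on a compact set.
  have hK := isCompact_closedBall (0 : Fin n → ℂ) c⁻¹
  have hb : ∀ j, ∃ C, ∀ y ∈ Metric.closedBall (0 : Fin n → ℂ) c⁻¹,
      ‖MvPolynomial.eval y (R j)‖ ≤ C := fun j =>
    hK.exists_bound_of_continuousOn (MvPolynomial.continuous_eval (R j)).continuousOn
  choose C hC using hb
  have hle : ∀ j, C j ≤ ∑ j, |C j| := fun j =>
    (le_abs_self _).trans (Finset.single_le_sum (fun j _ => abs_nonneg (C j)) (Finset.mem_univ j))
  refine ⟨∑ j, |C j|, Finset.sum_nonneg fun j _ => abs_nonneg _, fun x hx j => ?_⟩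
  unfold ratFunDeriv
  split_ifs with h
  · have hmem : invForms σ x ∈ Metric.closedBall (0 : Fin n → ℂ) c⁻¹ := by
      rw [mem_closedBall_zero_iff, pi_norm_le_iff_of_nonneg (inv_nonneg.2 hc.le)]
      intro i
      rw [invForms, norm_inv]
      exact inv_anti₀ hc (hx i (h i))
    rw [hPQ x h, hR j, map_mul, MvPolynomial.eval_X, norm_mul, invForms, norm_inv, mul_right_comm,
      inv_mul_cancel₀ (norm_ne_zero_iff.2 (h j)), one_mul]
    exact (hC j _ hmem).trans (hle j)
  · rw [norm_zero, zero_mul]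
    exact Finset.sum_nonneg fun j _ => abs_nonneg _

/-- Columns drawn from different `Aₖ` may be dependent; `x` then cannot be recovered from the forms,
but nothing needs bounding. -/
theorem ratFunDeriv_eq_zero_of_det {n : ℕ} {σ : Matrix (Fin n) (Fin n) ℂ} (hσ : σ.det = 0)
    (P : MvPolynomial (Fin n) ℂ) (x : Fin n → ℂ) : ratFunDeriv σ P x = 0 := by
  have h0 : ratFun σ = fun _ => 0 := by
    funext y
    simp [ratFun, hσ]
  have hp : ∀ i : Fin n, partialDeriv i (fun _ => (0 : ℂ)) = fun _ => 0 := fun i => by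
    funext y
    simp [partialDeriv, lineDeriv]
  have hm : ∀ α : Fin n →₀ ℕ, multiDeriv α (fun _ => (0 : ℂ)) = fun _ => 0 := fun α => by
    unfold multiDeriv
    induction List.finRange n with
    | nil => rfl
    | cons i l ih =>
      rw [List.foldr_cons, ih]
      exact Function.iterate_fixed (hp i) _
  unfold ratFunDeriv
  split_ifs
  · simp [negDiffOp, h0, hm]
  · rfl

/-- If the forms `⟨x, σⱼ⟩` are bounded below, then `P(-∂) f(σ)` is `O(1 / ‖x‖)`. -/
theorem exists_norm_ratFunDeriv_mul_norm_le {n : ℕ} (σ : Matrix (Fin n) (Fin n) ℂ)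
    (P : MvPolynomial (Fin n) ℂ) {c : ℝ} (hc : 0 < c) :
    ∃ C, 0 ≤ C ∧ ∀ x, (∀ j, x ⬝ᵥ σ.col j ≠ 0 → c ≤ ‖x ⬝ᵥ σ.col j‖) →
      ∀ i, ‖ratFunDeriv σ P x‖ * ‖x i‖ ≤ C := by
  by_cases hσ : σ.det = 0
  · exact ⟨0, le_rfl, fun x _ i => by simp [ratFunDeriv_eq_zero_of_det hσ]⟩
  obtain ⟨C, hC0, hC⟩ := exists_norm_ratFunDeriv_mul_le σ P hc
  refine ⟨∑ i, ∑ j, C * ‖σ⁻¹ j i‖, by positivity, fun x hx i => ?_⟩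
  have hxi : x i = ∑ j, (x ⬝ᵥ σ.col j) * σ⁻¹ j i := by
    have h : x ᵥ* σ ᵥ* σ⁻¹ = x := by
      rw [Matrix.vecMul_vecMul, Matrix.mul_nonsing_inv _ (isUnit_iff_ne_zero.2 hσ),
        Matrix.vecMul_one]
    exact (congrFun h i).symm
  calc ‖ratFunDeriv σ P x‖ * ‖x i‖
      ≤ ‖ratFunDeriv σ P x‖ * ∑ j, ‖x ⬝ᵥ σ.col j‖ * ‖σ⁻¹ j i‖ := by
        refine mul_le_mul_of_nonneg_left ?_ (norm_nonneg _)
        rw [hxi]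
        exact (norm_sum_le _ _).trans (Finset.sum_le_sum fun j _ => (norm_mul _ _).le)
    _ = ∑ j, ‖ratFunDeriv σ P x‖ * ‖x ⬝ᵥ σ.col j‖ * ‖σ⁻¹ j i‖ := by
        rw [Finset.mul_sum]
        exact Finset.sum_congr rfl fun j _ => (mul_assoc _ _ _).symm
    _ ≤ ∑ j, C * ‖σ⁻¹ j i‖ :=
        Finset.sum_le_sum fun j _ => mul_le_mul_of_nonneg_right (hC x hx j) (norm_nonneg _)
    _ ≤ ∑ i, ∑ j, C * ‖σ⁻¹ j i‖ :=
        Finset.single_le_sum (f := fun i => ∑ j, C * ‖σ⁻¹ j i‖)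
          (fun i _ => by positivity) (Finset.mem_univ i)

/-! ### Lower bounds for norms and linear forms on finitely generated groups -/

theorem exists_smul_isIntegral_of_fg {K : Type*} [Field K] [Algebra.IsAlgebraic ℤ K]
    (L : Submodule ℤ K) (hL : L.FG) : ∃ d : ℤ, d ≠ 0 ∧ ∀ x ∈ L, IsIntegral ℤ (d • x) := by
  induction L, hL using Submodule.fg_induction with
  | singleton x =>
    obtain ⟨d, hd, hx⟩ := (Algebra.IsAlgebraic.isAlgebraic (R := ℤ) x).exists_integral_multiple
    refine ⟨d, hd, fun y hy => ?_⟩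
    obtain ⟨a, rfl⟩ := Submodule.mem_span_singleton.1 hy
    rw [smul_comm]
    exact hx.smul a
  | sup L₁ L₂ _ _ h₁ h₂ =>
    obtain ⟨d, hd, hL₁⟩ := h₁
    obtain ⟨e, he, hL₂⟩ := h₂
    refine ⟨d * e, mul_ne_zero hd he, fun y hy => ?_⟩
    obtain ⟨y₁, hy₁, y₂, hy₂, rfl⟩ := Submodule.mem_sup.1 hy
    rw [smul_add]
    refine IsIntegral.add ?_ ?_
    · rw [mul_comm, mul_smul]
      exact (hL₁ y₁ hy₁).smul e
    · rw [mul_smul]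
      exact (hL₂ y₂ hy₂).smul d

theorem isAlgebraic_int_of_finiteDimensional (F K : Type*) [Field F] [NumberField F] [Field K]
    [Algebra F K] [FiniteDimensional F K] : Algebra.IsAlgebraic ℤ K := by
  have : CharZero K := charZero_of_injective_algebraMap (algebraMap F K).injective
  have : Algebra.IsAlgebraic ℚ K := Algebra.IsAlgebraic.trans ℚ F K
  exact (IsFractionRing.comap_isAlgebraic_iff (A := ℤ) (K := ℚ)).2 this

section ImaginaryQuadratic

variable {F : Type u} [Field F] [NumberField F] [NumberField.IsTotallyComplex F]
  [Algebra.IsQuadraticExtension ℚ F] [Algebra F ℂ]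

/-- `F` has a single infinite place, so the condition at the other places in `one_le_of_lt_one` is
vacuous. -/
theorem one_le_norm_algebraMap {a : F} (ha : IsIntegral ℤ a) (ha0 : a ≠ 0) :
    1 ≤ ‖algebraMap F ℂ a‖ := by
  have h1 : NumberField.InfinitePlace.nrComplexPlaces F = 1 := by
    have h := NumberField.IsTotallyComplex.finrank F
    rw [Algebra.IsQuadraticExtension.finrank_eq_two ℚ F] at h
    omega
  have h2 : Fintype.card (NumberField.InfinitePlace F) = 1 := by
    rw [NumberField.InfinitePlace.card_eq_nrRealPlaces_add_nrComplexPlaces, h1,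
      NumberField.IsTotallyComplex.nrRealPlaces_eq_zero]
  have : Subsingleton (NumberField.InfinitePlace F) :=
    Fintype.card_le_one_iff_subsingleton.1 h2.le
  have h := NumberField.InfinitePlace.one_le_of_lt_one
    (w := NumberField.InfinitePlace.mk (algebraMap F ℂ)) (a := ⟨a, ha⟩)
    (fun h => ha0 (congrArg Subtype.val h)) fun z hz => absurd (Subsingleton.elim _ _) hz
  rwa [NumberField.InfinitePlace.apply] at h

/-- The nonzero norms to `F` of the elements of a finitely generated group are bounded below. -/
theorem exists_le_norm_algebraNorm {K : Type*} [Field K] [Algebra F K] [FiniteDimensional F K]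
    (L : Submodule ℤ K) (hL : L.FG) :
    ∃ c : ℝ, 0 < c ∧ ∀ y ∈ L, y ≠ 0 → c ≤ ‖algebraMap F ℂ (Algebra.norm F y)‖ := by
  have := isAlgebraic_int_of_finiteDimensional F K
  have : CharZero K := charZero_of_injective_algebraMap (algebraMap F K).injective
  obtain ⟨d, hd, hint⟩ := exists_smul_isIntegral_of_fg L hL
  have hd0 : (0 : ℝ) < |(d : ℝ)| := abs_pos.2 (by exact_mod_cast hd)
  -- Clearing the denominator `d` multiplies the norm by `d ^ [K : F]`.
  refine ⟨(|(d : ℝ)| ^ Module.finrank F K)⁻¹, by positivity, fun y hy hy0 => ?_⟩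
  have hne : d • y ≠ 0 := by
    rw [zsmul_eq_mul]
    exact mul_ne_zero (by exact_mod_cast hd) hy0
  have h := one_le_norm_algebraMap (Algebra.isIntegral_norm F (hint y hy))
    (Algebra.norm_ne_zero_iff.2 hne)
  have hmap : d • y = algebraMap F K d * y := by rw [zsmul_eq_mul, map_intCast]
  rw [hmap, map_mul, Algebra.norm_algebraMap, map_mul, map_pow, map_intCast, norm_mul, norm_pow,
    Complex.norm_intCast] at h
  rwa [inv_le_iff_one_le_mul₀' (by positivity)]

/-- The nonzero values of finitely many linear forms on a finitely generated group are bounded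
below. -/
theorem exists_le_norm_dotProduct {n : ℕ} (L : Submodule ℤ F) (hL : L.FG)
    (σ : Matrix (Fin n) (Fin n) F) :
    ∃ c : ℝ, 0 < c ∧ ∀ x : Fin n → F, (∀ i, x i ∈ L) → ∀ j, x ⬝ᵥ σ.col j ≠ 0 →
      c ≤ ‖algebraMap F ℂ (x ⬝ᵥ σ.col j)‖ := by
  let N : Submodule ℤ F := Submodule.span ℤ (Set.range fun p : Fin n × Fin n => σ p.1 p.2)
  -- Here `K = F`, where the norm is the identity.
  obtain ⟨c, hc, h⟩ := exists_le_norm_algebraNorm (F := F) (L * N)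
    (hL.mul (Submodule.fg_span (Set.finite_range _)))
  refine ⟨c, hc, fun x hx j h0 => ?_⟩
  have hmem : x ⬝ᵥ σ.col j ∈ L * N :=
    Submodule.sum_mem _ fun i _ =>
      Submodule.mul_mem_mul (hx i) (Submodule.subset_span (Set.mem_range_self (i, j)))
  simpa using h _ hmem h0

/-- For `M ∈ R_n`, the products `∏ⱼ |x Mⱼ|` are bounded below on a finitely generated group. -/
theorem exists_le_prod_norm_of_mem_conjugateMatrices {n : ℕ} {M : GL (Fin n) ℂ}
    (hM : M ∈ conjugateMatrices F n) (L : Submodule ℤ F) (hL : L.FG) :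
    ∃ c : ℝ, 0 < c ∧ ∀ x : Fin n → F, (∀ i, x i ∈ L) → x ≠ 0 →
      c ≤ ∏ j, ‖(fun i => algebraMap F ℂ (x i)) ⬝ᵥ (M : Matrix (Fin n) (Fin n) ℂ).col j‖ := by
  obtain ⟨K, _, _, m, ρ, hfin, hrank, hinj, hMρ⟩ := hM
  -- The `ρⱼ` exhaust the embeddings over `F`, so the product over `j` is the full norm.
  have hbij : Function.Bijective ρ := by
    rw [Fintype.bijective_iff_injective_and_card]
    exact ⟨hinj, by rw [AlgHom.card, hrank, Fintype.card_fin]⟩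
  have hval : ∀ (x : Fin n → F) (j : Fin n),
      (fun i => algebraMap F ℂ (x i)) ⬝ᵥ (M : Matrix (Fin n) (Fin n) ℂ).col j =
        ρ j (∑ i, x i • m i) := by
    intro x j
    simp [dotProduct, hMρ, map_sum, Algebra.smul_def]
  let f : F →ₗ[ℤ] K := (algebraMap F K).toAddMonoidHom.toIntLinearMap
  obtain ⟨c, hc, h⟩ := exists_le_norm_algebraNorm (F := F)
    (L.map f * Submodule.span ℤ (Set.range m))
    ((hL.map f).mul (Submodule.fg_span (Set.finite_range m)))
  refine ⟨c, hc, fun x hx hx0 => ?_⟩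
  have hmem : ∑ i, x i • m i ∈ L.map f * Submodule.span ℤ (Set.range m) :=
    Submodule.sum_mem _ fun i _ => by
      rw [Algebra.smul_def]
      exact Submodule.mul_mem_mul (Submodule.mem_map_of_mem (f := f) (hx i))
        (Submodule.subset_span (Set.mem_range_self i))
  have hne : ∑ i, x i • m i ≠ 0 := by
    intro h0
    have hx' : (fun i => algebraMap F ℂ (x i)) ≠ 0 := fun h' => hx0 <| funext fun i => by
      simpa using congrFun h' i
    obtain ⟨j, hj⟩ := exists_col_ne_zero M hx'
    exact hj (by rw [hval, h0, map_zero])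
  refine (h _ hmem hne).trans_eq ?_
  rw [Algebra.norm_eq_prod_embeddings, norm_prod,
    ← Function.Bijective.prod_comp hbij fun τ : K →ₐ[F] ℂ => ‖τ (∑ i, x i • m i)‖]
  exact Finset.prod_congr rfl fun j _ => by rw [hval]

end ImaginaryQuadratic

/-! ### Size of the terms and convergence of the series -/

theorem norm_Omega {n : ℕ} (k : ℤ) (s : ℂ) (x : Fin n → ℂ) (M : GL (Fin n) ℂ)
    (hx : ∀ i, x ⬝ᵥ (M : Matrix (Fin n) (Fin n) ℂ).col i ≠ 0) :
    ‖Omega k s x M‖ =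
      ∏ i, ‖x ⬝ᵥ (M : Matrix (Fin n) (Fin n) ℂ).col i‖ ^ (-(2 * s.re - k)) := by
  rw [Omega, norm_prod]
  refine Finset.prod_congr rfl fun i _ => ?_
  have h := norm_pos_iff.2 (hx i)
  rw [norm_div, norm_zpow, RCLike.norm_conj, Complex.norm_cpow_eq_rpow_re_of_pos h, neg_sub,
    Real.rpow_sub h, Real.rpow_intCast]
  simp

section ImaginaryQuadratic

variable {F : Type u} [Field F] [NumberField F] [NumberField.IsTotallyComplex F]
  [Algebra.IsQuadraticExtension ℚ F] [Algebra F ℂ]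

/-- On a finitely generated group, the rational cocycle is `O(1 / ‖x‖)`. -/
theorem exists_norm_psi_mul_norm_le {n : ℕ} (L : Submodule ℤ F) (hL : L.FG)
    (A : Fin n → GL (Fin n) F) (P : MvPolynomial (Fin n) ℂ) :
    ∃ C : ℝ, 0 ≤ C ∧ ∀ x : Fin n → F, (∀ i, x i ∈ L) → ∀ i,
      ‖psi (fun i => Matrix.GeneralLinearGroup.map (algebraMap F ℂ) (A i)) P
        (fun i => algebraMap F ℂ (x i))‖ * ‖algebraMap F ℂ (x i)‖ ≤ C := by
  -- Only finitely many column choices `J` can occur, so the sum of their constants serves for all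
  -- `x`.
  have key : ∀ J : Fin n → Fin n, ∃ C : ℝ, 0 ≤ C ∧ ∀ x : Fin n → F, (∀ i, x i ∈ L) → ∀ i,
      ‖ratFunDeriv (Matrix.of fun i k => (Matrix.GeneralLinearGroup.map (algebraMap F ℂ) (A k) :
        Matrix (Fin n) (Fin n) ℂ) i (J k)) P (fun i => algebraMap F ℂ (x i))‖ *
          ‖algebraMap F ℂ (x i)‖ ≤ C := by
    intro J
    obtain ⟨c, hc, h⟩ := exists_le_norm_dotProduct L hL
      (Matrix.of fun i k => (A k : Matrix (Fin n) (Fin n) F) i (J k))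
    obtain ⟨C, hC0, hC⟩ := exists_norm_ratFunDeriv_mul_norm_le
      (Matrix.of fun i k => (Matrix.GeneralLinearGroup.map (algebraMap F ℂ) (A k) :
        Matrix (Fin n) (Fin n) ℂ) i (J k)) P hc
    refine ⟨C, hC0, fun x hx => hC _ fun j hj => ?_⟩
    have hmap : (fun i => algebraMap F ℂ (x i)) ⬝ᵥ
        (Matrix.of fun i k => (Matrix.GeneralLinearGroup.map (algebraMap F ℂ) (A k) :
          Matrix (Fin n) (Fin n) ℂ) i (J k)).col j =
        algebraMap F ℂ (x ⬝ᵥ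
          (Matrix.of fun i k => (A k : Matrix (Fin n) (Fin n) F) i (J k)).col j) := by
      simp [dotProduct, map_sum]
    rw [hmap] at hj ⊢
    exact h x hx j fun h0 => hj (by rw [h0, map_zero])
  choose C hC0 hC using key
  refine ⟨∑ J, C J, Finset.sum_nonneg fun J _ => hC0 J, fun x hx i => ?_⟩
  unfold psi
  split_ifs with h
  · rw [norm_zero, zero_mul]
    exact Finset.sum_nonneg fun J _ => hC0 J
  · exact (hC (fun k => firstIndex _ h) x hx i).trans
      (Finset.single_le_sum (fun J _ => hC0 J) (Finset.mem_univ _))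

theorem summable_norm_eisensteinTerm {n : ℕ} (hn : n ≠ 0) (Λ : Fin n → Submodule ℤ F)
    (hΛ : ∀ i, (Λ i).FG) (A : Fin n → GL (Fin n) F) (P : MvPolynomial (Fin n) ℂ) (v : Fin n → F)
    {M : GL (Fin n) ℂ} (hM : M ∈ conjugateMatrices F n) (k : ℤ) (s : ℂ)
    (hs : 1 + (k : ℝ) / 2 < s.re) :
    Summable fun x : latticeCoset Λ v => ‖eisensteinTerm k s A P M x‖ := by
  -- A single group containing all coordinates of coset points, hence of their differences as well.
  let L : Submodule ℤ F := (⨆ i, Λ i) ⊔ Submodule.span ℤ (Set.range v)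
  have hL : L.FG := (Submodule.fg_iSup _ hΛ).sup (Submodule.fg_span (Set.finite_range v))
  have hsub : ∀ {x : Fin n → F}, x ∈ latticeCoset Λ v → ∀ i, x i - v i ∈ L := fun hx i =>
    Submodule.mem_sup_left (Submodule.mem_iSup_of_mem i (hx i))
  have hmem : ∀ {x : Fin n → F}, x ∈ latticeCoset Λ v → ∀ i, x i ∈ L := fun {x} hx i => by
    have h := L.add_mem (hsub hx i)
      (Submodule.mem_sup_right (Submodule.subset_span (Set.mem_range_self i)))
    rwa [sub_add_cancel] at h
  obtain ⟨c, hc, hcM⟩ := exists_le_prod_norm_of_mem_conjugateMatrices hM L hL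
  obtain ⟨C, hC0, hC⟩ := exists_norm_psi_mul_norm_le L hL A P
  let z : (Fin n → F) → Fin n → ℂ := fun x j =>
    (fun i => algebraMap F ℂ (x i)) ⬝ᵥ (M : Matrix (Fin n) (Fin n) ℂ).col j
  have hzsub : ∀ x y j, z x j - z y j = z (x - y) j := fun x y j => by
    simp only [z]
    rw [← sub_dotProduct]
    congr 1
    funext i
    simp
  -- The lower bound on the product fails at the origin, where the term vanishes anyway.
  let S := {x : latticeCoset Λ v // x.1 ≠ 0}
  have hpos : ∀ x : S, c ≤ ∏ j, ‖z x.1.1 j‖ := fun x => hcM _ (hmem x.1.2) x.2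
  have hne : ∀ (x : S) j, z x.1.1 j ≠ 0 := fun x j h0 => by
    have h := hpos x
    rw [Finset.prod_eq_zero (Finset.mem_univ j) (by rw [h0, norm_zero])] at h
    linarith
  have hS : Summable fun x : S => ‖eisensteinTerm k s A P M x.1.1‖ := by
    refine summable_of_prod_norm_sub hn (fun x : S => z x.1.1) hc ?_ hne hpos
      (w := 2 * s.re - k) (by linarith) (fun x => norm_nonneg _)
      (C := ∑ j, ∑ i, C * ‖(M : Matrix (Fin n) (Fin n) ℂ) i j‖) (by positivity) ?_
    · intro x y hxy
      simp only [hzsub]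
      refine hcM _ (fun i => ?_) (sub_ne_zero.2 fun h => hxy (Subtype.ext (Subtype.ext h)))
      exact L.sub_mem (hmem x.1.2 i) (hmem y.1.2 i)
    · intro x j
      rw [eisensteinTerm, norm_mul, norm_Omega k s _ M (hne x), mul_right_comm]
      refine mul_le_mul_of_nonneg_right ?_ (by positivity)
      refine le_trans ?_ (Finset.single_le_sum
        (f := fun j => ∑ i, C * ‖(M : Matrix (Fin n) (Fin n) ℂ) i j‖)
        (fun j _ => by positivity) (Finset.mem_univ j))
      refine (mul_le_mul_of_nonneg_left (norm_sum_le _ _) (norm_nonneg _)).trans ?_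
      rw [Finset.mul_sum]
      refine Finset.sum_le_sum fun i _ => ?_
      rw [norm_mul, ← mul_assoc]
      exact mul_le_mul_of_nonneg_right (hC _ (hmem x.1.2) i) (norm_nonneg _)
  refine (Subtype.val_injective.summable_iff (g := fun x : S => x.1) fun x hx => ?_).1 hS
  have hx0 : x.1 = 0 := by
    by_contra h
    exact hx ⟨⟨x, h⟩, rfl⟩
  have h0 : (fun i => algebraMap F ℂ (x.1 i)) = 0 := by
    funext i
    simp [hx0]
  rw [eisensteinTerm, h0]
  simp [psi]

end ImaginaryQuadratic

end EisensteinCocycle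

end

/-- `F` is an imaginary quadratic field with a fixed embedding into `ℂ`, `𝚲` is a product of `n`
lattices in `F` with ring of multipliers `𝓞 F`. The series defining the Eisenstein cocycle converges
absolutely for `Re s > 1 + k / 2`. -/
theorem mainTheorem4 {F : Type*} [Field F] [NumberField F] [NumberField.IsTotallyComplex F]
    [Algebra.IsQuadraticExtension ℚ F] [Algebra F ℂ]
    (n : ℕ) (hn : 1 ≤ n)
    (Λ : Fin n → Submodule ℤ F) (hΛ : ∀ i, Submodule.IsLattice ℚ (Λ i))
    (hmult : ∀ i, EisensteinCocycle.multiplierRing (Λ i) = (integralClosure ℤ F).toSubring)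
    (A : Fin n → Matrix.GeneralLinearGroup (Fin n) F)
    (g : ℕ) (P : MvPolynomial (Fin n) ℂ) (hP : P.IsHomogeneous g)
    (v : Fin n → F)
    (M : Matrix.GeneralLinearGroup (Fin n) ℂ) (hM : M ∈ EisensteinCocycle.conjugateMatrices F n)
    (k : ℤ) (s : ℂ) (hs : 1 + (k : ℝ) / 2 < s.re) :
    (Summable fun x : EisensteinCocycle.latticeCoset Λ v =>
      ‖EisensteinCocycle.eisensteinTerm k s A P M x‖) ∧
    HasSum (fun x : EisensteinCocycle.latticeCoset Λ v =>
      EisensteinCocycle.eisensteinTerm k s A P M x) (EisensteinCocycle.Psi Λ k s A P v M) := by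
  have h := EisensteinCocycle.summable_norm_eisensteinTerm (Nat.one_le_iff_ne_zero.1 hn) Λ
    (fun i => (hΛ i).fg) A P v hM k s hs
  exact ⟨h, h.of_norm.hasSum⟩
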